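/- Let $q$ be a positive integer (the case $q=0$ with empty tuples is also allowed), and let $A=(a_1,\dots,a_q)$, $B=(b_1,\dots,b_q)$ be real tuples such that $B$ is weakly supermajorized by $A$, that is, $$0<a_1\le a_2\le\cdots\le a_q,\qquad 0<b_1\le b_2\le\cdots\le b_q,\qquad \sum_{i=1}^{k}a_i\le\sum_{i=1}^{k}b_i\quad(k=1,\dots,q).$$ For real $\sigma\ge 0$ let ${}_{q+1}F_q(\sigma,A;B;z)$ denote the analytic continuation to $\mathbb{C}\setminus[1,\infty)$ of the series $$\sum_{n=0}^{\infty}\frac{(\sigma)_n(a_1)_n\cdots(a_q)_n}{(b_1)_n\cdots(b_q)_n\,n!}\,z^n,\qquad |z|<1,$$ where $(a)_0=1$ and $(a)_n=a(a+1)\cdots(a+n-1)$ for $n\ge1$. This series converges for $|z|<1$ and the (unique) analytic continuation exists. Moreover, for each real $x<1$ the values $f(\sigma)={}_{q+1}F_q(\sigma,A;B;x)$, $\sigma\ge0$, are real and positive, and the function $\sigma\mapsto f(\sigma)$ is log-convex on $[0,\infty)$, i.e. $\sigma\mapsto\log f(\sigma)$ is convex on $[0,\infty)$. -/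

import Mathlib

noncomputable section

namespace GenHyp

/-- `B ≺^W A`: both tuples are positive and weakly increasing, and every partial sum of `A` is at
most the corresponding partial sum of `B`. -/
structure WeaklySupermajorizedBy {q : ℕ} (B A : Fin q → ℝ) : Prop where
  pos_left : ∀ i, 0 < B i
  pos_right : ∀ i, 0 < A i
  mono_left : Monotone B
  mono_right : Monotone A
  sum_le : ∀ k : Fin q, ∑ i ∈ Finset.Iic k, A i ≤ ∑ i ∈ Finset.Iic k, B i

/-- The `n`-th Taylor coefficient `(σ)_n (a_1)_n ⋯ (a_q)_n / ((b_1)_n ⋯ (b_q)_n n!)`, where `(a)_n`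
is the rising factorial. -/
def coeff {q : ℕ} (σ : ℝ) (A B : Fin q → ℝ) (n : ℕ) : ℝ :=
  ((ascPochhammer ℝ n).eval σ * ∏ i, (ascPochhammer ℝ n).eval (A i)) /
    ((∏ i, (ascPochhammer ℝ n).eval (B i)) * (n.factorial : ℝ))

/-- The complex plane cut along the ray `[1, ∞)`. -/
def cutPlane : Set ℂ := {z | z.re < 1 ∨ z.im ≠ 0}

/-- `F` is holomorphic on the cut plane, and in the open unit disk it is the sum of the
(convergent) hypergeometric series. -/
structure IsExtension {q : ℕ} (σ : ℝ) (A B : Fin q → ℝ) (F : ℂ → ℂ) : Prop where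
  differentiableOn : DifferentiableOn ℂ F cutPlane
  hasSum : ∀ z : ℂ, ‖z‖ < 1 → HasSum (fun n : ℕ => (coeff σ A B n : ℂ) * z ^ n) (F z)

open Classical in
/-- The generalized hypergeometric function `_{q+1}F_q(σ, A; B; z)` on the cut plane: the analytic
continuation of the hypergeometric series (it is unique on the cut plane, see
`IsExtension.eqOn`). -/
def hyp {q : ℕ} (σ : ℝ) (A B : Fin q → ℝ) : ℂ → ℂ :=
  if h : ∃ F : ℂ → ℂ, IsExtension σ A B F then h.choose else 0

/-- `f` is log-convex on `s`: it is positive there and its logarithm is convex. -/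
def LogConvexOn (s : Set ℝ) (f : ℝ → ℝ) : Prop :=
  (∀ t ∈ s, 0 < f t) ∧ ConvexOn ℝ s (fun t => Real.log (f t))

theorem isOpen_cutPlane : IsOpen cutPlane :=
  (isOpen_lt Complex.continuous_re continuous_const).union
    (isOpen_ne_fun Complex.continuous_im continuous_const)

theorem isPreconnected_cutPlane : IsPreconnected cutPlane := by
  have hstar : StarConvex ℝ (0 : ℂ) cutPlane := by
    rw [starConvex_zero_iff]
    intro z hz a ha0 ha1
    change z.re < 1 ∨ z.im ≠ 0 at hz
    change (a • z).re < 1 ∨ (a • z).im ≠ 0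
    simp only [Complex.real_smul, Complex.mul_re, Complex.mul_im,
      Complex.ofReal_re, Complex.ofReal_im, zero_mul, sub_zero, add_zero]
    rcases hz with hz | hz
    · left
      rcases le_total z.re 0 with h | h
      · linarith [mul_nonpos_of_nonneg_of_nonpos ha0 h]
      · linarith [mul_le_of_le_one_left h ha1]
    · rcases ha0.eq_or_lt with rfl | ha0
      · left
        simp
      · right
        exact mul_ne_zero ha0.ne' hz
  have h0 : (0 : ℂ) ∈ cutPlane := by simp [cutPlane]
  exact (hstar.isPathConnected h0).isConnected.isPreconnected

/-- Two analytic continuations of the hypergeometric series agree on the cut plane. -/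
theorem IsExtension.eqOn {q : ℕ} {σ : ℝ} {A B : Fin q → ℝ} {F G : ℂ → ℂ}
    (hF : IsExtension σ A B F) (hG : IsExtension σ A B G) : Set.EqOn F G cutPlane := by
  have h0 : (0 : ℂ) ∈ cutPlane := by simp [cutPlane]
  refine (hF.differentiableOn.analyticOnNhd isOpen_cutPlane).eqOn_of_preconnected_of_eventuallyEq
    (hG.differentiableOn.analyticOnNhd isOpen_cutPlane) isPreconnected_cutPlane h0 ?_
  filter_upwards [Metric.ball_mem_nhds (0 : ℂ) one_pos] with z hz
  have hz' : ‖z‖ < 1 := by simpa using hz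
  exact (hF.hasSum z hz').unique (hG.hasSum z hz')

/-- `hyp` is an analytic continuation of the series as soon as there is one. -/
theorem isExtension_hyp {q : ℕ} {σ : ℝ} {A B : Fin q → ℝ} {F : ℂ → ℂ}
    (hF : IsExtension σ A B F) : IsExtension σ A B (hyp σ A B) := by
  have h : ∃ F : ℂ → ℂ, IsExtension σ A B F := ⟨F, hF⟩
  rw [hyp, dif_pos h]
  exact h.choose_spec

end GenHyp

end

open MeasureTheory Filter Topology Finset

namespace GenHyp

/-! The quotients `∏ (a_i)_n / (b_i)_n` are the moments of one probability measure `μ` on `[0,1]`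
(`isMomentSeq_prod_ascPochhammer`). Summing the binomial series under the integral gives `hyp σ A B
z = ∫ (1 - t z)^(-σ) dμ(t)`, and Hölder's inequality in `σ` yields log-convexity.

To find `μ`, the quotient is written as a limit over `K` of products over `k < K` of rational
sequences with parameters `A + k`, `B + k`. Each of these is a moment sequence by induction on `q`
(`isMomentSeq_prod_ratio`). Moment sequences survive products, mixing with a point mass at `1`, and
pointwise limits. -/

/-! ### Moment sequences and their closure properties -/

/-- `m` is the moment sequence of a probability measure on the unit interval. -/
def IsMomentSeq (m : ℕ → ℝ) : Prop :=
  ∃ μ : ProbabilityMeasure unitInterval, ∀ n, m n = ∫ t, (t : ℝ) ^ n ∂(μ : Measure unitInterval)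

theorem integrable_of_continuous_unitInterval {E : Type*} [NormedAddCommGroup E]
    {μ : Measure unitInterval} [IsFiniteMeasure μ] {f : unitInterval → E} (hf : Continuous f) :
    Integrable f μ :=
  hf.integrable_of_hasCompactSupport (HasCompactSupport.of_compactSpace f)

/-- Probability measures on a compact space are weakly compact, so their image under the continuous
moment map is compact. -/
theorem isClosed_setOf_isMomentSeq : IsClosed {m : ℕ → ℝ | IsMomentSeq m} := by
  have hcont : Continuous fun (μ : ProbabilityMeasure unitInterval) (n : ℕ) =>
      ∫ t, (t : ℝ) ^ n ∂(μ : Measure unitInterval) := by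
    refine continuous_pi fun n => ?_
    exact ProbabilityMeasure.continuous_integral_boundedContinuousFunction
      (BoundedContinuousFunction.mkOfCompact ⟨fun t : unitInterval => (t : ℝ) ^ n, by fun_prop⟩)
  convert (isCompact_range hcont).isClosed using 1
  ext m
  simp only [IsMomentSeq, Set.mem_ofPred_eq, Set.mem_range, funext_iff, eq_comm]

theorem IsMomentSeq.of_tendsto {m : ℕ → ℕ → ℝ} {l : ℕ → ℝ} (hm : ∀ K, IsMomentSeq (m K))
    (hl : ∀ n, Tendsto (fun K => m K n) atTop (𝓝 (l n))) : IsMomentSeq l :=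
  isClosed_setOf_isMomentSeq.mem_of_tendsto (tendsto_pi_nhds.2 hl) (Eventually.of_forall hm)

theorem isMomentSeq_one : IsMomentSeq fun _ => 1 :=
  ⟨⟨Measure.dirac 1, inferInstance⟩, fun n => by simp⟩

/-- The product of independent variables with laws `μ` and `ν` has these moments. -/
theorem IsMomentSeq.mul {m m' : ℕ → ℝ} (h : IsMomentSeq m) (h' : IsMomentSeq m') :
    IsMomentSeq fun n => m n * m' n := by
  obtain ⟨μ, hμ⟩ := h
  obtain ⟨ν, hν⟩ := h'
  have hmul : Measurable fun p : unitInterval × unitInterval => p.1 * p.2 :=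
    (continuous_fst.mul continuous_snd).measurable
  refine ⟨⟨((μ : Measure unitInterval).prod (ν : Measure unitInterval)).map fun p => p.1 * p.2,
    Measure.isProbabilityMeasure_map hmul.aemeasurable⟩, fun n => ?_⟩
  have hc : Continuous fun t : unitInterval => (t : ℝ) ^ n := by fun_prop
  rw [ProbabilityMeasure.coe_mk, integral_map hmul.aemeasurable hc.aestronglyMeasurable]
  change m n * m' n = _
  rw [hμ, hν, ← integral_prod_mul]
  simp [mul_pow]

theorem IsMomentSeq.prod {ι : Type*} (s : Finset ι) {m : ι → ℕ → ℝ}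
    (h : ∀ i ∈ s, IsMomentSeq (m i)) : IsMomentSeq fun n => ∏ i ∈ s, m i n := by
  classical
  induction s using Finset.induction_on with
  | empty => simpa using isMomentSeq_one
  | insert a s ha ih =>
    simp only [Finset.prod_insert ha]
    exact (h a (by simp)).mul (ih fun i hi => h i (by simp [hi]))

theorem IsMomentSeq.convexComb_one {m : ℕ → ℝ} (h : IsMomentSeq m) {c : ℝ} (hc0 : 0 ≤ c)
    (hc1 : c ≤ 1) : IsMomentSeq fun n => c + (1 - c) * m n := by
  obtain ⟨μ, hμ⟩ := h
  have hc1' : 0 ≤ 1 - c := sub_nonneg.2 hc1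
  refine ⟨⟨ENNReal.ofReal c • Measure.dirac 1 +
    ENNReal.ofReal (1 - c) • (μ : Measure unitInterval),
    ⟨?_⟩⟩, fun n => ?_⟩
  · simp [← ENNReal.ofReal_add hc0 hc1']
  · have hc : Continuous fun t : unitInterval => (t : ℝ) ^ n := by fun_prop
    rw [ProbabilityMeasure.coe_mk, integral_add_measure
      ((integrable_of_continuous_unitInterval hc).smul_measure ENNReal.ofReal_ne_top)
      ((integrable_of_continuous_unitInterval hc).smul_measure ENNReal.ofReal_ne_top),
      integral_smul_measure, integral_smul_measure, ← hμ]
    simp [hc0, hc1']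

/-! ### Rational moment sequences -/

/-- These are the moments of `U^(1/a)` with `U` uniform on `[0,1]`. -/
theorem isMomentSeq_div_add {a : ℝ} (ha : 0 < a) : IsMomentSeq fun n => a / (a + n) := by
  have hmeas : Measurable fun t : unitInterval => (⟨(t : ℝ) ^ (1 / a), Real.rpow_nonneg t.2.1 _,
      Real.rpow_le_one t.2.1 t.2.2 (by positivity)⟩ : unitInterval) :=
    (measurable_subtype_coe.pow_const _).subtype_mk
  refine ⟨⟨(volume : Measure unitInterval).map _,
    Measure.isProbabilityMeasure_map hmeas.aemeasurable⟩,
    fun n => ?_⟩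
  have hc : Continuous fun t : unitInterval => (t : ℝ) ^ n := by fun_prop
  rw [ProbabilityMeasure.coe_mk, integral_map hmeas.aemeasurable hc.aestronglyMeasurable]
  have h1 : ∀ t : unitInterval, ((t : ℝ) ^ (1 / a)) ^ n = (t : ℝ) ^ (n / a : ℝ) := fun t => by
    rw [← Real.rpow_natCast, ← Real.rpow_mul t.2.1]
    congr 1
    ring
  simp only [h1]
  have hn : (0 : ℝ) ≤ n / a := by positivity
  have h2 := integral_subtype_comap (μ := volume) (s := Set.Icc (0 : ℝ) 1) measurableSet_Icc
    (fun t : ℝ => t ^ (n / a : ℝ))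
  refine Eq.trans ?_ h2.symm
  rw [integral_Icc_eq_integral_Ioc, ← intervalIntegral.integral_of_le zero_le_one,
    integral_rpow (Or.inl (by linarith))]
  rw [Real.one_rpow, Real.zero_rpow (by positivity)]
  field_simp
  ring

theorem isMomentSeq_ratio {a b : ℝ} (ha : 0 < a) (hab : a ≤ b) :
    IsMomentSeq fun n => a / (a + n) / (b / (b + n)) := by
  have hb : 0 < b := ha.trans_le hab
  convert (isMomentSeq_div_add ha).convexComb_one (c := a / b) (by positivity)
    ((div_le_one hb).2 hab) using 2 with n
  field_simp
  ring

/-- With `w = x + y - z`, the difference `(z+n)(w+n) - (x+n)(y+n)` does not depend on `n`, so the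
ratio is a mixture of `1` and `xy/((x+n)(y+n))`. The weight `xy/(zw)` is at most `1` because `zw -
xy = (z-x)(y-z)`. -/
theorem isMomentSeq_ratio_transfer {x y z : ℝ} (hx : 0 < x) (hxz : x ≤ z) (hzy : z ≤ y) :
    IsMomentSeq fun n => x / (x + n) * (y / (y + n)) /
      (z / (z + n) * ((x + y - z) / (x + y - z + n))) := by
  obtain ⟨w, hw⟩ : ∃ w, w = x + y - z := ⟨_, rfl⟩
  rw [← hw]
  have hz : 0 < z := by linarith
  have hy : 0 < y := by linarith
  have hw0 : 0 < w := by linarith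
  convert ((isMomentSeq_div_add hx).mul (isMomentSeq_div_add hy)).convexComb_one
    (c := x * y / (z * w)) (by positivity)
    ((div_le_one (by positivity)).2 (by subst hw; nlinarith)) using 2 with n
  obtain rfl : y = w + z - x := by linarith
  field_simp
  ring

/-- A transfer between two entries of `A` creates the entry `B 0`, which cancels. Monotonicity of
`A` is not assumed, since the transfer may destroy it. -/
theorem isMomentSeq_prod_ratio {q : ℕ} (A B : Fin q → ℝ) (hA : ∀ i, 0 < A i)
    (hB : ∀ i, 0 < B i) (hmono : Monotone B)
    (hsum : ∀ k, ∑ i ∈ Finset.Iic k, A i ≤ ∑ i ∈ Finset.Iic k, B i) :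
    IsMomentSeq fun n => (∏ i, A i / (A i + n)) / ∏ i, B i / (B i + n) := by
  induction q with
  | zero => simpa using isMomentSeq_one
  | succ q ih =>
    have h0 : A 0 ≤ B 0 := by
      have h : Finset.Iic (0 : Fin (q + 1)) = {0} := by
        ext i; simp
      simpa [h] using hsum 0
    have hpos : ∀ {a : ℝ} (n : ℕ), 0 < a → 0 < a / (a + n) := fun n ha => by positivity
    by_cases hj : ∃ j : Fin q, B 0 < A j.succ
    · obtain ⟨j, hj, hmin⟩ : ∃ j : Fin q, B 0 < A j.succ ∧ ∀ i < j, A i.succ ≤ B 0 := by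
        obtain ⟨j, hj⟩ := hj
        exact ⟨_, WellFounded.min_mem wellFounded_lt {j : Fin q | B 0 < A j.succ} ⟨j, hj⟩,
          fun i hi => not_lt.1 fun h =>
            WellFounded.not_lt_min wellFounded_lt {j : Fin q | B 0 < A j.succ} h hi⟩
      set w := A 0 + A j.succ - B 0 with hw
      have hw0 : 0 < w := by linarith [hA 0]
      have key := (isMomentSeq_ratio_transfer (hA 0) h0 hj.le).mul
        (ih (Function.update (fun i => A i.succ) j w) (fun i => B i.succ) ?_
          (fun i => hB _) (fun i k hik => hmono (Fin.succ_le_succ_iff.2 hik)) ?_)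
      · convert key using 2 with n
        have h1 : ∏ i, Function.update (fun i => A i.succ) j w i /
            (Function.update (fun i => A i.succ) j w i + n) =
            w / (w + n) * ∏ i ∈ univ.erase j, A i.succ / (A i.succ + n) := by
          rw [← Finset.mul_prod_erase univ _ (Finset.mem_univ j), Function.update_self]
          congr 1
          refine Finset.prod_congr rfl fun i hi => ?_
          rw [Function.update_of_ne (Finset.ne_of_mem_erase hi)]
        rw [h1, Fin.prod_univ_succ, Fin.prod_univ_succ, ← Finset.mul_prod_erase univ
          (fun i : Fin q => A i.succ / (A i.succ + n)) (Finset.mem_univ j), ← hw]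
        have h2 := (Finset.prod_pos fun (i : Fin q) (_ : i ∈ univ) => hpos n (hB i.succ)).ne'
        have h3 := (hpos n (hB 0)).ne'
        have h4 := (hpos n hw0).ne'
        generalize w / (w + n) = W at *
        generalize B 0 / (B 0 + n) = W' at *
        field_simp
      · intro i
        by_cases hij : i = j
        · subst hij; simpa using hw0
        · simpa [hij] using hA i.succ
      · intro k
        -- From `j` on, `w` carries the surplus `A 0 - B 0`, so the original partial sum inequality
        -- is recovered.
        by_cases hkj : j ≤ k
        · have hs := hsum k.succ
          have hIic : Finset.Iic k.succ = insert 0 ((Finset.Iic k).map (Fin.succEmb q)) := by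
            ext i
            refine Fin.cases ?_ (fun i => ?_) i <;> simp
          have hIic' : ∀ C : Fin (q + 1) → ℝ,
              ∑ i ∈ Finset.Iic k.succ, C i = C 0 + ∑ i ∈ Finset.Iic k, C i.succ := fun C => by
            rw [hIic, Finset.sum_insert (by simp), Finset.sum_map]; rfl
          rw [hIic', hIic'] at hs
          rw [Finset.sum_update_of_mem (by simpa using hkj)]
          rw [← Finset.add_sum_erase _ (fun i : Fin q => A i.succ)
            (Finset.mem_Iic.2 hkj), ← Finset.sdiff_singleton_eq_erase] at hs
          linarith
        · refine Finset.sum_le_sum fun i hi => ?_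
          have hij : i < j := (Finset.mem_Iic.1 hi).trans_lt (not_le.1 hkj)
          rw [Function.update_of_ne hij.ne]
          exact (hmin i hij).trans (hmono (Fin.zero_le _))
    · push Not at hj
      have hle : ∀ i, A i ≤ B i := fun i => by
        refine Fin.cases h0 (fun i => ?_) i
        exact (hj i).trans (hmono (Fin.zero_le _))
      simp only [← Finset.prod_div_distrib]
      exact IsMomentSeq.prod _ fun i _ => isMomentSeq_ratio (hA i) (hle i)

/-! ### Pochhammer quotients as limits -/

/-- The product telescopes, since `c / (c + n) = (c)_n / (c + 1)_n`. -/
theorem ascPochhammer_eval_div_eq_mul_prod {a b : ℝ} (ha : 0 < a) (hb : 0 < b) (n K : ℕ) :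
    ∏ k ∈ range K, ((a + k) / (a + k + n)) / ((b + k) / (b + k + n)) =
      (ascPochhammer ℝ n).eval a / (ascPochhammer ℝ n).eval b *
        ((ascPochhammer ℝ n).eval (b + K) / (ascPochhammer ℝ n).eval (a + K)) := by
  have hp : ∀ {c : ℝ}, 0 < c → (ascPochhammer ℝ n).eval c ≠ 0 := fun hc =>
    (ascPochhammer_pos n _ hc).ne'
  have hshift : ∀ c : ℝ, c * (ascPochhammer ℝ n).eval (c + 1) =
      (ascPochhammer ℝ n).eval c * (c + n) := fun c => by
    rw [← ascPochhammer_succ_eval, ascPochhammer_succ_left]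
    simp
  induction K with
  | zero =>
    have := hp ha
    have := hp hb
    simp
    field_simp
  | succ K ih =>
    have haK : 0 < a + K := by positivity
    have hbK : 0 < b + K := by positivity
    have h1 := hshift (a + K)
    have h2 := hshift (b + K)
    rw [Finset.prod_range_succ, ih, Nat.cast_succ, ← add_assoc, ← add_assoc]
    have e1 := hp haK
    have e2 := hp hbK
    have e4 := hp ha
    have e5 := hp hb
    rw [mul_comm, ← eq_div_iff haK.ne'] at h1
    rw [mul_comm, ← eq_div_iff hbK.ne'] at h2
    rw [h1, h2]
    field_simp

theorem tendsto_ascPochhammer_eval_ratio (a b : ℝ) (n : ℕ) :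
    Tendsto (fun K : ℕ => (ascPochhammer ℝ n).eval (b + K) / (ascPochhammer ℝ n).eval (a + K))
      atTop (𝓝 1) := by
  induction n with
  | zero => simp
  | succ n ih =>
    have h := ih.mul (tendsto_add_mul_div_add_mul_atTop_nhds (b + n) (a + n) (1 : ℝ) one_ne_zero)
    simp only [div_one, mul_one] at h
    refine h.congr fun K => ?_
    rw [ascPochhammer_succ_eval, ascPochhammer_succ_eval, mul_div_mul_comm]
    congr 2 <;> ring

theorem isMomentSeq_prod_ascPochhammer {q : ℕ} {A B : Fin q → ℝ}
    (h : WeaklySupermajorizedBy B A) :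
    IsMomentSeq fun n => ∏ i, (ascPochhammer ℝ n).eval (A i) / (ascPochhammer ℝ n).eval (B i) := by
  refine IsMomentSeq.of_tendsto (m := fun K n => ∏ k ∈ range K,
    ((∏ i, (A i + k) / (A i + k + n)) / ∏ i, (B i + k) / (B i + k + n)))
    (fun K => IsMomentSeq.prod _ fun k _ => ?_) fun n => ?_
  · refine isMomentSeq_prod_ratio (fun i => A i + k) (fun i => B i + k)
      (fun i => by have := h.pos_right i; positivity)
      (fun i => by have := h.pos_left i; positivity)
      (fun i j hij => by simpa using h.mono_left hij) fun j => ?_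
    simpa [Finset.sum_add_distrib] using h.sum_le j
  · simp only [← Finset.prod_div_distrib]
    simp_rw [Finset.prod_comm (s := range _),
      ascPochhammer_eval_div_eq_mul_prod (h.pos_right _) (h.pos_left _)]
    refine tendsto_finsetProd _ fun i _ => ?_
    simpa using (tendsto_ascPochhammer_eval_ratio (A i) (B i) n).const_mul
      ((ascPochhammer ℝ n).eval (A i) / (ascPochhammer ℝ n).eval (B i))

/-! ### The integral representation on the cut plane -/

theorem one_sub_mul_mem_slitPlane {z : ℂ} (hz : z ∈ cutPlane) (t : unitInterval) :
    1 - (t : ℂ) * z ∈ Complex.slitPlane := by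
  rw [Complex.mem_slitPlane_iff]
  simp only [Complex.sub_re, Complex.sub_im, Complex.one_re, Complex.one_im, Complex.mul_re,
    Complex.mul_im, Complex.ofReal_re, Complex.ofReal_im, zero_mul, sub_zero, add_zero, zero_sub,
    neg_ne_zero]
  have ht0 := t.2.1
  have ht1 := t.2.2
  rcases hz with hz | hz
  · left
    rcases le_total z.re 0 with h | h
    · nlinarith
    · nlinarith
  · rcases ht0.eq_or_lt with h | h
    · left
      simp [← h]
    · exact Or.inr (mul_ne_zero h.ne' hz)

theorem hasSum_one_sub_cpow_neg (σ : ℝ) {w : ℂ} (hw : ‖w‖ < 1) :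
    HasSum (fun n : ℕ => (((ascPochhammer ℝ n).eval σ / n.factorial : ℝ) : ℂ) * w ^ n)
      ((1 - w) ^ (-σ : ℂ)) := by
  have h := (Complex.one_div_one_sub_cpow_hasFPowerSeriesOnBall_zero (σ : ℂ)).hasSum (y := w)
    (by simpa [← ofReal_norm] using hw)
  simp only [FormalMultilinearSeries.ofScalars_apply_eq, zero_add, smul_eq_mul] at h
  have key : ∀ n : ℕ, Ring.choose ((σ : ℂ) + n - 1) n =
      (((ascPochhammer ℝ n).eval σ / n.factorial : ℝ) : ℂ) := fun n => by
    have h1 := Ring.factorial_nsmul_multichoose_eq_ascPochhammer σ n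
    rw [Polynomial.ascPochhammer_smeval_eq_eval, nsmul_eq_mul] at h1
    have h2 : (σ : ℂ) + n - 1 = ((σ + n - 1 : ℝ) : ℂ) := by push_cast; ring
    rw [h2, ← Complex.ofReal_choose, Ring.choose, ← h1, mul_div_cancel_left₀ _ (by positivity)]
    congr 2
    ring
  simpa only [key, one_div, ← Complex.cpow_neg] using h

/-- The generalized Stieltjes transform `∫ (1 - t z)^(-σ) dμ(t)`. -/
noncomputable def stieltjes (μ : Measure unitInterval) (σ : ℝ) (z : ℂ) : ℂ :=
  ∫ t : unitInterval, (1 - (t : ℂ) * z) ^ (-σ : ℂ) ∂μ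

theorem continuous_one_sub_mul_cpow {z : ℂ} (hz : z ∈ cutPlane) (c : ℂ) :
    Continuous fun t : unitInterval => (1 - (t : ℂ) * z) ^ c :=
  Continuous.cpow (by fun_prop) continuous_const fun t => one_sub_mul_mem_slitPlane hz t

theorem differentiableOn_stieltjes (μ : Measure unitInterval) [IsFiniteMeasure μ] (σ : ℝ) :
    DifferentiableOn ℂ (stieltjes μ σ) cutPlane := by
  intro z₀ hz₀
  -- Compactness of `K × [0,1]` supplies a constant dominating the `z`-derivative of the integrand.
  obtain ⟨K, hK, hKz, hKs⟩ := exists_compact_subset isOpen_cutPlane hz₀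
  let F' : ℂ → unitInterval → ℂ := fun z t => -σ * (1 - (t : ℂ) * z) ^ (-σ - 1 : ℂ) * (-t)
  have hcont : ContinuousOn (fun p : ℂ × unitInterval => F' p.1 p.2) (K ×ˢ Set.univ) := by
    refine (continuousOn_const.mul (ContinuousOn.cpow (by fun_prop) continuousOn_const
      fun p hp => ?_)).mul
      (by fun_prop)
    exact one_sub_mul_mem_slitPlane (hKs hp.1) p.2
  obtain ⟨C, hC⟩ := (hK.prod isCompact_univ).exists_bound_of_continuousOn hcont
  refine (hasDerivAt_integral_of_dominated_loc_of_deriv_le (F' := F') (bound := fun _ => C)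
    (mem_interior_iff_mem_nhds.1 hKz) ?_ ?_ ?_ ?_ (integrable_const C) ?_
    ).2.differentiableAt.differentiableWithinAt
  · filter_upwards [isOpen_cutPlane.mem_nhds hz₀] with z hz
    exact (continuous_one_sub_mul_cpow hz _).aestronglyMeasurable
  · exact integrable_of_continuous_unitInterval (continuous_one_sub_mul_cpow hz₀ _)
  · exact ((continuous_const.mul (continuous_one_sub_mul_cpow hz₀ _)).mul
      (by fun_prop)).aestronglyMeasurable
  · exact Eventually.of_forall fun t z hz => hC (z, t) ⟨hz, Set.mem_univ t⟩
  · refine Eventually.of_forall fun t z hz => ?_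
    have h : HasDerivAt (fun z : ℂ => 1 - (t : ℂ) * z) (-t) z := by
      simpa using ((hasDerivAt_id z).const_mul (t : ℂ)).const_sub 1
    exact h.cpow_const (one_sub_mul_mem_slitPlane (hKs hz) t)

theorem isExtension_stieltjes {q : ℕ} (σ : ℝ) {A B : Fin q → ℝ} {μ : Measure unitInterval}
    [IsFiniteMeasure μ] (hμ : ∀ n : ℕ,
      ∏ i, (ascPochhammer ℝ n).eval (A i) / (ascPochhammer ℝ n).eval (B i) =
        ∫ t : unitInterval, (t : ℝ) ^ n ∂μ) :
    IsExtension σ A B (stieltjes μ σ) := by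
  refine ⟨differentiableOn_stieltjes μ σ, fun z hz => ?_⟩
  let c : ℕ → ℝ := fun n => (ascPochhammer ℝ n).eval σ / n.factorial
  have htz : ∀ t : unitInterval, ‖(t : ℂ) * z‖ ≤ ‖z‖ := fun t => by
    rw [norm_mul, Complex.norm_real, Real.norm_of_nonneg t.2.1]
    exact mul_le_of_le_one_left (norm_nonneg z) t.2.2
  have hF : ∀ n, Continuous fun t : unitInterval => (c n : ℂ) * ((t : ℂ) * z) ^ n := fun n => by
    fun_prop
  have hsummable : Summable fun n => ‖(c n : ℂ) * z ^ n‖ :=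
    (hasSum_one_sub_cpow_neg σ hz).summable.norm
  have h := hasSum_integral_of_summable_integral_norm (μ := μ)
    (fun n => integrable_of_continuous_unitInterval (hF n)) ?_
  · have h1 : ∀ t : unitInterval,
        ∑' n, (c n : ℂ) * ((t : ℂ) * z) ^ n = (1 - (t : ℂ) * z) ^ (-σ : ℂ) :=
      fun t => (hasSum_one_sub_cpow_neg σ ((htz t).trans_lt hz)).tsum_eq
    simp only [h1] at h
    have h2 : ∀ n, ∫ t : unitInterval, (c n : ℂ) * ((t : ℂ) * z) ^ n ∂μ =
        (coeff σ A B n : ℂ) * z ^ n := fun n => by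
      have h3 : coeff σ A B n = c n * ∫ t : unitInterval, (t : ℝ) ^ n ∂μ := by
        rw [← hμ, Finset.prod_div_distrib, coeff, mul_comm (∏ i, _) (n.factorial : ℝ),
          mul_div_mul_comm]
      rw [h3, Complex.ofReal_mul, ← integral_complex_ofReal, mul_assoc, ← integral_mul_const,
        ← integral_const_mul]
      simp [mul_pow]
    simp only [h2] at h
    exact h
  · refine Summable.of_nonneg_of_le (fun n => integral_nonneg fun t => norm_nonneg _)
      (fun n => ?_) (hsummable.mul_right (μ.real Set.univ))
    refine (integral_mono (integrable_of_continuous_unitInterval (hF n).norm)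
      (integrable_const ‖(c n : ℂ) * z ^ n‖) fun t => ?_).trans_eq (by simp [mul_comm])
    simp only [norm_mul, norm_pow]
    gcongr
    simpa using htz t

/-! ### Positivity and log-convexity -/

theorem one_sub_mul_pos {x : ℝ} (hx : x < 1) (t : unitInterval) : 0 < 1 - (t : ℝ) * x := by
  have h := one_sub_mul_mem_slitPlane (z := (x : ℂ)) (Or.inl (by simpa using hx)) t
  rw [← Complex.ofReal_mul, ← Complex.ofReal_one, ← Complex.ofReal_sub] at h
  exact Complex.ofReal_mem_slitPlane.1 h

theorem stieltjes_ofReal (μ : Measure unitInterval) (σ : ℝ) {x : ℝ} (hx : x < 1) :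
    stieltjes μ σ x = ((∫ t : unitInterval, (1 - (t : ℝ) * x) ^ (-σ) ∂μ : ℝ) : ℂ) := by
  rw [← integral_complex_ofReal, stieltjes]
  congr 1 with t
  rw [Complex.ofReal_cpow (one_sub_mul_pos hx t).le]
  push_cast
  rfl

theorem continuous_one_sub_mul_rpow {x : ℝ} (hx : x < 1) (c : ℝ) :
    Continuous fun t : unitInterval => (1 - (t : ℝ) * x) ^ c :=
  Continuous.rpow_const (by fun_prop) fun t => Or.inl (one_sub_mul_pos hx t).ne'

theorem integral_one_sub_mul_rpow_pos (μ : Measure unitInterval) [IsProbabilityMeasure μ] {x : ℝ}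
    (hx : x < 1) (c : ℝ) : 0 < ∫ t : unitInterval, (1 - (t : ℝ) * x) ^ c ∂μ := by
  have hpos : ∀ t : unitInterval, 0 < (1 - (t : ℝ) * x) ^ c := fun t =>
    Real.rpow_pos_of_pos (one_sub_mul_pos hx t) c
  rw [integral_pos_iff_support_of_nonneg (fun t => (hpos t).le)
    (integrable_of_continuous_unitInterval (continuous_one_sub_mul_rpow hx c))]
  have : Function.support (fun t : unitInterval => (1 - (t : ℝ) * x) ^ c) = Set.univ :=
    Set.eq_univ_of_forall fun t => (hpos t).ne'
  simp [this]

/-- Hölder's inequality with exponents `1/a` and `1/b`. -/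
theorem integral_one_sub_mul_rpow_le (μ : Measure unitInterval) [IsProbabilityMeasure μ] {x : ℝ}
    (hx : x < 1) (σ τ : ℝ) {a b : ℝ} (ha : 0 < a) (hb : 0 < b) (hab : a + b = 1) :
    ∫ t : unitInterval, (1 - (t : ℝ) * x) ^ (-(a * σ + b * τ)) ∂μ ≤
      (∫ t : unitInterval, (1 - (t : ℝ) * x) ^ (-σ) ∂μ) ^ a *
        (∫ t : unitInterval, (1 - (t : ℝ) * x) ^ (-τ) ∂μ) ^ b := by
  have hpq : (1 / a).HolderConjugate (1 / b) := by
    rw [Real.holderConjugate_iff]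
    exact ⟨(one_lt_div ha).2 (by linarith), by simpa using hab⟩
  have hmem : ∀ c p : ℝ,
      MemLp (fun t : unitInterval => (1 - (t : ℝ) * x) ^ c) (ENNReal.ofReal p) μ :=
    fun c p => (continuous_one_sub_mul_rpow hx c).memLp_of_hasCompactSupport
      (HasCompactSupport.of_compactSpace _)
  have h := integral_mul_le_Lp_mul_Lq_of_nonneg hpq (μ := μ)
    (f := fun t : unitInterval => (1 - (t : ℝ) * x) ^ (-(a * σ)))
    (g := fun t : unitInterval => (1 - (t : ℝ) * x) ^ (-(b * τ)))
    (Eventually.of_forall fun t => Real.rpow_nonneg (one_sub_mul_pos hx t).le _)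
    (Eventually.of_forall fun t => Real.rpow_nonneg (one_sub_mul_pos hx t).le _)
    (hmem _ _) (hmem _ _)
  simp only [one_div_one_div] at h
  have hmul : ∀ t : unitInterval,
      (1 - (t : ℝ) * x) ^ (-(a * σ)) * (1 - (t : ℝ) * x) ^ (-(b * τ)) =
      (1 - (t : ℝ) * x) ^ (-(a * σ + b * τ)) := fun t => by
    rw [← Real.rpow_add (one_sub_mul_pos hx t), ← neg_add]
  have hpow : ∀ (c ρ : ℝ), 0 < c → ∀ t : unitInterval,
      ((1 - (t : ℝ) * x) ^ (-(c * ρ))) ^ (1 / c) = (1 - (t : ℝ) * x) ^ (-ρ) := fun c ρ hc t => by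
    rw [← Real.rpow_mul (one_sub_mul_pos hx t).le]
    congr 1
    field_simp
  simpa only [hmul, hpow a σ ha, hpow b τ hb] using h

theorem logConvexOn_integral_one_sub_mul_rpow (μ : Measure unitInterval)
    [IsProbabilityMeasure μ] {x : ℝ} (hx : x < 1) :
    LogConvexOn (Set.Ici 0) fun σ => ∫ t : unitInterval, (1 - (t : ℝ) * x) ^ (-σ) ∂μ := by
  have hpos := fun c => integral_one_sub_mul_rpow_pos μ hx c
  refine ⟨fun σ _ => hpos _, convexOn_iff_forall_pos.2 ⟨convex_Ici 0, ?_⟩⟩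
  intro σ _ τ _ a b ha hb hab
  simp only [smul_eq_mul]
  rw [← Real.log_rpow (hpos _), ← Real.log_rpow (hpos _),
    ← Real.log_mul (Real.rpow_pos_of_pos (hpos _) _).ne' (Real.rpow_pos_of_pos (hpos _) _).ne']
  exact Real.log_le_log (hpos _) (integral_one_sub_mul_rpow_le μ hx σ τ ha hb hab)

end GenHyp

theorem mainTheorem3 {q : ℕ} (A B : Fin q → ℝ) (hBA : GenHyp.WeaklySupermajorizedBy B A) :
    (∀ σ : ℝ, 0 ≤ σ → GenHyp.IsExtension σ A B (GenHyp.hyp σ A B)) ∧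
    ∀ x : ℝ, x < 1 →
      (∀ σ : ℝ, 0 ≤ σ → (GenHyp.hyp σ A B (x : ℂ)).im = 0) ∧
      GenHyp.LogConvexOn (Set.Ici 0) (fun σ : ℝ => (GenHyp.hyp σ A B (x : ℂ)).re) := by
  obtain ⟨μ, hμ⟩ := GenHyp.isMomentSeq_prod_ascPochhammer hBA
  have hext := fun σ : ℝ => GenHyp.isExtension_stieltjes σ hμ
  have hhyp := fun σ : ℝ => GenHyp.isExtension_hyp (hext σ)
  refine ⟨fun σ _ => hhyp σ, fun x hx => ?_⟩
  have hval : ∀ σ : ℝ, GenHyp.hyp σ A B (x : ℂ) = _ := fun σ =>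
    ((hhyp σ).eqOn (hext σ) (Or.inl (by simpa using hx))).trans
      (GenHyp.stieltjes_ofReal (μ : MeasureTheory.Measure unitInterval) σ hx)
  refine ⟨fun σ _ => by rw [hval, Complex.ofReal_im], ?_⟩
  simp only [hval, Complex.ofReal_re]
  exact GenHyp.logConvexOn_integral_one_sub_mul_rpow _ hx
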